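/- Let $n\ge 0$ and $N\ge 1$ be integers and let $A=(A_1,\dots,A_n)$ be an $n$-tuple of complex $N\times N$ matrices which is hyperbolic, i.e. for every $\xi\in\mathbb R^n$ the spectrum of $\langle\xi,A\rangle=\sum_{j=1}^n\xi_jA_j$ is contained in $\mathbb R$. Let $\|\cdot\|$ be the operator norm of matrices induced by the Euclidean norm on $\mathbb C^N$, put $\|A\|=\big(\sum_{j=1}^n\|A_j\|^2\big)^{1/2}$, let $|\cdot|$ be the Euclidean norm on $\mathbb R^n$, and write $\langle\zeta,A\rangle=\sum_{j=1}^n\zeta_jA_j$ for $\zeta\in\mathbb C^n$. Then: (1) For every $r>\|A\|$ there is a constant $C>0$ such that $$\big\|e^{i\langle\zeta,A\rangle}\big\|\le C\,(1+|\xi|)^{N-1}e^{r|\eta|}\qquad\text{for all }\zeta=\xi+i\eta,\ \xi,\eta\in\mathbb R^n .$$ (2) The Weyl functional calculus $\mathcal W_A$ of $A$ exists: with $\hat f(\xi)=\int_{\mathbb R^n}e^{-i\langle x,\xi\rangle}f(x)\,dx$, for every Schwartz function $f\in\mathcal S(\mathbb R^n)$ the integral $$\langle\mathcal W_A,f\rangle=\frac1{(2\pi)^n}\int_{\mathbb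 R^n}e^{i\langle\xi,A\rangle}\hat f(\xi)\,d\xi$$ converges absolutely, and $f\mapsto\langle\mathcal W_A,f\rangle$ is a matrix-valued tempered distribution on $\mathbb R^n$. Moreover $\mathcal W_A$ has compact support, and for every $r>\|A\|$ its support is contained in the closed ball of radius $r$ centred at $0$. -/

import Mathlib

open scoped Matrix.Norms.L2Operator SchwartzMap

noncomputable section

namespace WeylCalculus

/-- The linear combination `⟨A, ζ⟩ = ∑ j, ζ_j A_j` of an `n`-tuple of matrices, for `ζ ∈ ℂⁿ`. -/
def pairing {n N : ℕ} (A : Fin n → Matrix (Fin N) (Fin N) ℂ) (ζ : Fin n → ℂ) :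
    Matrix (Fin N) (Fin N) ℂ :=
  ∑ j, ζ j • A j

/-- The tuple `A` is hyperbolic: every real linear combination of the `A_j` has real spectrum. -/
def IsHyperbolic {n N : ℕ} (A : Fin n → Matrix (Fin N) (Fin N) ℂ) : Prop :=
  ∀ ξ : Fin n → ℝ, spectrum ℂ (pairing A fun j => (ξ j : ℂ)) ⊆ Set.range ((↑) : ℝ → ℂ)

/-- The norm `‖A‖ = (∑ j, ‖A_j‖²)^{1/2}` of a tuple of matrices; `‖A_j‖` is the operator norm
induced by the Euclidean norm of `ℂᴺ`. -/
def tupleNorm {n N : ℕ} (A : Fin n → Matrix (Fin N) (Fin N) ℂ) : ℝ :=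
  Real.sqrt (∑ j, ‖A j‖ ^ 2)

/-- The Fourier transform `f̂(ξ) = ∫ e^{-i⟨x, ξ⟩} f(x) dx`. -/
def fourierHat {n : ℕ} (f : 𝓢(EuclideanSpace ℝ (Fin n), ℂ)) (ξ : EuclideanSpace ℝ (Fin n)) : ℂ :=
  ∫ x, Complex.exp (-(Complex.I * (inner ℝ x ξ : ℝ))) * f x

/-- The function `ξ ↦ f̂(ξ) e^{i⟨A, ξ⟩}`. -/
def weylIntegrand {n N : ℕ} (A : Fin n → Matrix (Fin N) (Fin N) ℂ)
    (f : 𝓢(EuclideanSpace ℝ (Fin n), ℂ)) (ξ : EuclideanSpace ℝ (Fin n)) :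
    Matrix (Fin N) (Fin N) ℂ :=
  fourierHat f ξ • NormedSpace.exp (Complex.I • pairing A fun j => (ξ j : ℂ))

/-- The matrix-valued tempered distribution `W` is the Weyl functional calculus of `A`: the
integral `(2π)⁻ⁿ ∫ e^{i⟨A, ξ⟩} f̂(ξ) dξ` converges absolutely and equals `W f`, for every Schwartz
function `f`. -/
def IsWeylCalculus {n N : ℕ} (A : Fin n → Matrix (Fin N) (Fin N) ℂ)
    (W : 𝓢'(EuclideanSpace ℝ (Fin n), Matrix (Fin N) (Fin N) ℂ)) : Prop :=
  ∀ f : 𝓢(EuclideanSpace ℝ (Fin n), ℂ),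
    MeasureTheory.Integrable (weylIntegrand A f) ∧
      W f = ((2 * Real.pi : ℂ) ^ n)⁻¹ • ∫ ξ, weylIntegrand A f ξ

end WeylCalculus

end

open WeylCalculus

/-!
If `B` has real eigenvalues `z₁, …, z_N`, then Cayley–Hamilton says `∏ (B - z_j) = 0`, and removing
the eigenvalues one at a time shows that `e^{itB}` grows at most like `(1 + t ‖B‖)^{N-1}`. Applied
to `⟨ξ, A⟩` this bounds `e^{i⟨ξ, A⟩}` polynomially for real `ξ`. On the complex line
`z ↦ ξ + z η` the function `e^{i⟨ξ + zη, A⟩}` has exponential type `‖A‖ |η|` and grows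
polynomially on the real axis, so Phragmén–Lindelöf gives the growth `e^{‖A‖ |η|}` at `z = i`, up to
a power of `1 + |η|` that is absorbed by any `r > ‖A‖`.

The real estimate makes the Weyl calculus a tempered distribution. The complex one bounds its
support, as in the Paley–Wiener–Schwartz theorem: if `f` is supported in a half space
`⟨ω, x⟩ ≥ ρ` with `ρ > r |ω|`, shifting the contour of `∫ f̂(ξ) e^{i⟨ξ, A⟩} dξ` to imaginary part
`-tω` and letting `t → ∞` shows that the integral vanishes.
-/

namespace WeylCalculus

open Complex Filter MeasureTheory Metric Set Topology

section ExponentialBound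

open Polynomial

variable {𝔸 : Type*} [NormedRing 𝔸] [NormedAlgebra ℂ 𝔸]

theorem norm_exp_le [CompleteSpace 𝔸] (a : 𝔸) :
    ‖NormedSpace.exp a‖ ≤ ‖(1 : 𝔸)‖ * Real.exp ‖a‖ := by
  have hpow (n : ℕ) : ‖a ^ n‖ ≤ ‖(1 : 𝔸)‖ * ‖a‖ ^ n := by
    induction n with
    | zero => simp
    | succ n ih =>
      rw [pow_succ, pow_succ, ← mul_assoc]
      exact (norm_mul_le _ _).trans (by gcongr)
  have hsum := (NormedSpace.exp_series_hasSum_exp' (𝕂 := ℝ) ‖a‖).mul_left ‖(1 : 𝔸)‖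
  rw [← Real.exp_eq_exp_ℝ] at hsum
  rw [NormedSpace.exp_eq_tsum ℂ]
  refine tsum_of_norm_bounded hsum fun n => ?_
  rw [norm_smul, norm_inv, RCLike.norm_natCast, smul_eq_mul, mul_left_comm]
  gcongr
  exact hpow n

theorem norm_exp_smul_I_smul_sub_algebraMap_mul [CompleteSpace 𝔸] (b y : 𝔸) {z : ℂ}
    (hz : z.im = 0) (t : ℝ) :
    ‖NormedSpace.exp (t • (I • (b - algebraMap ℂ 𝔸 z))) * y‖ =
      ‖NormedSpace.exp (t • (I • b)) * y‖ := by
  let _ : NormedAlgebra ℚ 𝔸 := NormedAlgebra.restrictScalars ℚ ℂ 𝔸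
  obtain ⟨x, rfl⟩ : ∃ x : ℝ, (x : ℂ) = z := ⟨z.re, Complex.ext rfl (by simp [hz])⟩
  have hsplit : t • (I • (b - algebraMap ℂ 𝔸 x)) =
      algebraMap ℂ 𝔸 (((-(t * x) : ℝ) : ℂ) * I) + t • (I • b) := by
    simp only [Algebra.algebraMap_eq_smul_one, smul_sub, smul_smul, ← Complex.coe_smul]
    push_cast
    rw [sub_eq_neg_add, ← neg_smul]
    congr 2
    ring
  rw [hsplit, NormedSpace.exp_add_of_commute (Algebra.commutes _ _),
    ← NormedSpace.algebraMap_exp_comm, ← Complex.exp_eq_exp_ℂ, mul_assoc,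
    Algebra.algebraMap_eq_smul_one, smul_one_mul, norm_smul, Complex.norm_exp_ofReal_mul_I, one_mul]

theorem norm_exp_smul_mul_le_of_forall_norm_le [CompleteSpace 𝔸] (a y : 𝔸) {K t : ℝ} (ht : 0 ≤ t)
    (hK : ∀ s ∈ Ico 0 t, ‖NormedSpace.exp (s • a) * (a * y)‖ ≤ K) :
    ‖NormedSpace.exp (t • a) * y‖ ≤ ‖y‖ + K * t := by
  let _ : NormedAlgebra ℝ 𝔸 := NormedAlgebra.restrictScalars ℝ ℂ 𝔸
  have hderiv (s : ℝ) (_ : s ∈ Icc 0 t) :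
      HasDerivWithinAt (fun u : ℝ => NormedSpace.exp (u • a) * y)
        (NormedSpace.exp (s • a) * (a * y)) (Icc 0 t) s := by
    rw [← mul_assoc]
    exact ((hasDerivAt_exp_smul_const a s).mul_const y).hasDerivWithinAt
  have hmv := norm_image_sub_le_of_norm_deriv_le_segment' hderiv hK t ⟨ht, le_rfl⟩
  simp only [zero_smul, NormedSpace.exp_zero, one_mul, sub_zero] at hmv
  linarith [norm_le_norm_add_norm_sub' (NormedSpace.exp (t • a) * y) y]

/- Multiplying `y` by `b - z` removes the root `z`, and integrating the derivative of
`exp (s i (b - z)) y` over `[0, t]` puts it back at the cost of one factor `t c`. -/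
theorem norm_exp_smul_I_smul_mul_le_geom_sum [CompleteSpace 𝔸] (b : 𝔸) {c : ℝ} {s : Multiset ℂ}
    (hreal : ∀ z ∈ s, z.im = 0) (hc : ∀ z ∈ s, ‖b - algebraMap ℂ 𝔸 z‖ ≤ c) {y : 𝔸}
    (hy : aeval b (s.map fun z => X - C z).prod * y = 0) {t : ℝ} (ht : 0 ≤ t) :
    ‖NormedSpace.exp (t • (I • b)) * y‖ ≤ (∑ j ∈ Finset.range s.card, (t * c) ^ j) * ‖y‖ := by
  induction s using Multiset.induction generalizing y t with
  | empty => simp_all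
  | cons z s ih =>
    have hz := hc z (Multiset.mem_cons_self z s)
    have hc0 : 0 ≤ c := (norm_nonneg _).trans hz
    have hy' : aeval b (s.map fun z => X - C z).prod * ((b - algebraMap ℂ 𝔸 z) * y) = 0 := by
      rw [Multiset.map_cons, Multiset.prod_cons, mul_comm, map_mul, mul_assoc] at hy
      simpa using hy
    have hstep (u : ℝ) (hu : u ∈ Ico 0 t) :
        ‖NormedSpace.exp (u • (I • (b - algebraMap ℂ 𝔸 z))) *
          ((I • (b - algebraMap ℂ 𝔸 z)) * y)‖ ≤
          (∑ j ∈ Finset.range s.card, (t * c) ^ j) * (c * ‖y‖) := by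
      rw [norm_exp_smul_I_smul_sub_algebraMap_mul b _ (hreal z (Multiset.mem_cons_self z s)),
        smul_mul_assoc, mul_smul_comm, norm_smul, Complex.norm_I, one_mul]
      refine (ih (fun w hw => hreal w (Multiset.mem_cons_of_mem hw))
        (fun w hw => hc w (Multiset.mem_cons_of_mem hw)) hy' hu.1).trans ?_
      have hu0 := hu.1
      have hut := hu.2.le
      gcongr
      exact (norm_mul_le _ _).trans (by gcongr)
    rw [← norm_exp_smul_I_smul_sub_algebraMap_mul b y (hreal z (Multiset.mem_cons_self z s)),
      Multiset.card_cons, geom_sum_succ]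
    refine (norm_exp_smul_mul_le_of_forall_norm_le _ y ht hstep).trans_eq ?_
    ring

theorem geom_sum_le_one_add_pow {x : ℝ} (hx : 0 ≤ x) (m : ℕ) :
    ∑ j ∈ Finset.range m, x ^ j ≤ (1 + x) ^ (m - 1) := by
  cases m with
  | zero => simp
  | succ m =>
    rw [add_tsub_cancel_right, add_comm 1 x, add_pow]
    refine Finset.sum_le_sum fun j hj => ?_
    rw [one_pow, mul_one]
    exact le_mul_of_one_le_right (by positivity)
      (Nat.one_le_cast.2 <| Nat.choose_pos (Finset.mem_range_succ_iff.1 hj))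

theorem norm_exp_I_smul_le_of_spectrum_subset_real {m : Type*} [Fintype m] [DecidableEq m]
    {B : Matrix m m ℂ} (hB : spectrum ℂ B ⊆ range ((↑) : ℝ → ℂ)) :
    ‖NormedSpace.exp (I • B)‖ ≤ (1 + 2 * ‖B‖) ^ (Fintype.card m - 1) := by
  cases isEmpty_or_nonempty m
  · rw [Subsingleton.elim (NormedSpace.exp (I • B)) 0, norm_zero]
    positivity
  have hspec (z : ℂ) (hz : z ∈ B.charpoly.roots) : z ∈ spectrum ℂ B :=
    Matrix.mem_spectrum_iff_isRoot_charpoly.2 (isRoot_of_mem_roots hz)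
  have hreal (z : ℂ) (hz : z ∈ B.charpoly.roots) : z.im = 0 := by
    obtain ⟨x, rfl⟩ := hB (hspec z hz)
    exact ofReal_im x
  have hnorm (z : ℂ) (hz : z ∈ B.charpoly.roots) :
      ‖B - algebraMap ℂ (Matrix m m ℂ) z‖ ≤ 2 * ‖B‖ := by
    refine (norm_sub_le _ _).trans ?_
    rw [norm_algebraMap', two_mul]
    gcongr
    exact spectrum.norm_le_norm_of_mem (hspec z hz)
  have hcayley : aeval B (B.charpoly.roots.map fun z => X - C z).prod * 1 = 0 := by
    rw [← (IsAlgClosed.splits B.charpoly).eq_prod_roots_of_monic B.charpoly_monic,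
      Matrix.aeval_self_charpoly, zero_mul]
  have hcard : B.charpoly.roots.card = Fintype.card m := by
    rw [IsAlgClosed.card_roots_eq_natDegree, Matrix.charpoly_natDegree_eq_dim]
  have h := norm_exp_smul_I_smul_mul_le_geom_sum B hreal hnorm hcayley zero_le_one
  rw [one_smul, mul_one, one_mul, norm_one, mul_one, hcard] at h
  exact h.trans (geom_sum_le_one_add_pow (by positivity) _)

end ExponentialBound

section PhragmenLindelof

theorem one_add_abs_le_two_mul_norm_one_add_mul_I (y : ℝ) : 1 + |y| ≤ 2 * ‖1 + (y : ℂ) * I‖ := by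
  have hre := abs_re_le_norm (1 + (y : ℂ) * I)
  have him := abs_im_le_norm (1 + (y : ℂ) * I)
  simp only [add_re, one_re, mul_re, ofReal_re, I_re, mul_zero, ofReal_im, I_im, mul_one, sub_self,
    add_zero, abs_one, add_im, one_im, mul_im, zero_add] at hre him
  linarith

theorem one_le_norm_one_add_of_nonneg_re {w : ℂ} (hw : 0 ≤ w.re) : 1 ≤ ‖1 + w‖ := by
  refine le_trans ?_ (re_le_norm _)
  simpa using hw

variable {E : Type*} [NormedAddCommGroup E] [NormedSpace ℂ E] {F : ℂ → E} {C σ K : ℝ} {k : ℕ}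

/-- The comparison function of the Phragmén–Lindelöf argument: `F` is rotated, so that the upper
half-plane becomes the right half-plane, and divided by its expected size
`(1 + |w|) ^ k * exp (σ * re w)`. -/
noncomputable def normalizedRotation (σ : ℝ) (k : ℕ) (F : ℂ → E) (w : ℂ) : E :=
  Complex.exp (-(σ * w)) • ((1 + w) ^ k)⁻¹ • F (I * w)

theorem norm_normalizedRotation (w : ℂ) :
    ‖normalizedRotation σ k F w‖ =
      Real.exp (-(σ * w.re)) * ((‖1 + w‖ ^ k)⁻¹ * ‖F (I * w)‖) := by
  rw [normalizedRotation, norm_smul, norm_smul, norm_inv, norm_pow, Complex.norm_exp, neg_re,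
    re_ofReal_mul]

theorem diffContOnCl_normalizedRotation (hF : Differentiable ℂ F) :
    DiffContOnCl ℂ (normalizedRotation σ k F) {w | 0 < w.re} := by
  refine DifferentiableOn.diffContOnCl fun w hw => ?_
  rw [Complex.closure_setOfPred_lt_re] at hw
  have hw0 : (1 + w) ^ k ≠ 0 := pow_ne_zero k <| norm_pos_iff.1 <|
    zero_lt_one.trans_le (one_le_norm_one_add_of_nonneg_re hw)
  unfold normalizedRotation
  exact DifferentiableAt.differentiableWithinAt (by fun_prop (disch := exact hw0))

theorem norm_normalizedRotation_le (htype : ∀ z, ‖F z‖ ≤ C * Real.exp (σ * ‖z‖)) {w : ℂ}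
    (hw : 0 ≤ w.re) : ‖normalizedRotation σ k F w‖ ≤ C * Real.exp (σ * (‖w‖ - w.re)) := by
  have hweight : (‖1 + w‖ ^ k)⁻¹ ≤ 1 :=
    inv_le_one_of_one_le₀ (one_le_pow₀ (one_le_norm_one_add_of_nonneg_re hw))
  have hFw := htype (I * w)
  rw [norm_mul, norm_I, one_mul] at hFw
  calc ‖normalizedRotation σ k F w‖ ≤ Real.exp (-(σ * w.re)) * (1 * (C * Real.exp (σ * ‖w‖))) := by
        rw [norm_normalizedRotation]; gcongr
    _ = C * Real.exp (σ * (‖w‖ - w.re)) := by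
        rw [one_mul, mul_left_comm, ← Real.exp_add]; ring_nf

theorem norm_normalizedRotation_mul_I_le (hreal : ∀ x : ℝ, ‖F x‖ ≤ K * (1 + |x|) ^ k) (y : ℝ) :
    ‖normalizedRotation σ k F (y * I)‖ ≤ 2 ^ k * K := by
  have hpos : 0 < 1 + |y| := by positivity
  have hweight := one_add_abs_le_two_mul_norm_one_add_mul_I y
  have hFy := hreal (-y)
  rw [abs_neg] at hFy
  have hK : 0 ≤ K := nonneg_of_mul_nonneg_left ((norm_nonneg _).trans hFy) (pow_pos hpos k)
  have hy : I * (y * I) = ((-y : ℝ) : ℂ) := by rw [mul_left_comm, I_mul_I]; simp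
  rw [norm_normalizedRotation, hy, re_ofReal_mul, I_re, mul_zero, mul_zero, neg_zero, Real.exp_zero,
    one_mul, inv_mul_le_iff₀ (pow_pos (by linarith) k)]
  calc ‖F (-y : ℝ)‖ ≤ K * (1 + |y|) ^ k := hFy
    _ ≤ K * (2 * ‖1 + (y : ℂ) * I‖) ^ k := by gcongr
    _ = ‖1 + (y : ℂ) * I‖ ^ k * (2 ^ k * K) := by rw [mul_pow]; ring

theorem norm_normalizedRotation_le_of_nonneg_re (hF : Differentiable ℂ F)
    (htype : ∀ z, ‖F z‖ ≤ C * Real.exp (σ * ‖z‖))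
    (hreal : ∀ x : ℝ, ‖F x‖ ≤ K * (1 + |x|) ^ k) {w : ℂ} (hw : 0 ≤ w.re) :
    ‖normalizedRotation σ k F w‖ ≤ 2 ^ k * K := by
  have hC : 0 ≤ C := nonneg_of_mul_nonneg_left ((norm_nonneg _).trans (htype 0)) (Real.exp_pos _)
  refine PhragmenLindelof.right_half_plane_of_bounded_on_real (diffContOnCl_normalizedRotation hF)
    ⟨1, one_lt_two, |σ|, Asymptotics.IsBigO.of_bound C ?_⟩ ?_
    (norm_normalizedRotation_mul_I_le hreal) hw
  · refine eventually_inf_principal.2 (Eventually.of_forall fun v (hv : 0 < v.re) => ?_)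
    rw [Real.norm_of_nonneg (Real.exp_pos _).le, Real.rpow_one]
    refine (norm_normalizedRotation_le htype hv.le).trans ?_
    have hsub : 0 ≤ ‖v‖ - v.re := sub_nonneg.2 (re_le_norm v)
    gcongr
    · exact le_abs_self σ
    · linarith
  · refine isBoundedUnder_of_eventually_le (a := C) ?_
    filter_upwards [eventually_ge_atTop (0 : ℝ)] with x hx
    simpa [abs_of_nonneg hx] using norm_normalizedRotation_le htype (w := x) hx

theorem norm_le_mul_exp_im_of_forall_real_norm_le (hF : Differentiable ℂ F)
    (htype : ∀ z, ‖F z‖ ≤ C * Real.exp (σ * ‖z‖))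
    (hreal : ∀ x : ℝ, ‖F x‖ ≤ K * (1 + |x|) ^ k) {z : ℂ} (hz : 0 ≤ z.im) :
    ‖F z‖ ≤ 2 ^ k * K * (1 + ‖z‖) ^ k * Real.exp (σ * z.im) := by
  have hre : (-(I * z)).re = z.im := by simp
  have hK : 0 ≤ K := by simpa using (norm_nonneg _).trans (hreal 0)
  have hpos : 0 < ‖1 + -(I * z)‖ :=
    zero_lt_one.trans_le (one_le_norm_one_add_of_nonneg_re (hre.symm ▸ hz))
  have hweight : ‖1 + -(I * z)‖ ≤ 1 + ‖z‖ := (norm_add_le _ _).trans (by simp)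
  have hbound := norm_normalizedRotation_le_of_nonneg_re hF htype hreal (hre.symm ▸ hz)
  rw [norm_normalizedRotation, hre, Real.exp_neg, inv_mul_le_iff₀ (Real.exp_pos _),
    inv_mul_le_iff₀ (pow_pos hpos k), mul_neg, ← mul_assoc, I_mul_I, neg_one_mul, neg_neg] at hbound
  calc ‖F z‖ ≤ ‖1 + -(I * z)‖ ^ k * (Real.exp (σ * z.im) * (2 ^ k * K)) := hbound
    _ ≤ (1 + ‖z‖) ^ k * (Real.exp (σ * z.im) * (2 ^ k * K)) := by gcongr
    _ = 2 ^ k * K * (1 + ‖z‖) ^ k * Real.exp (σ * z.im) := by ring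

end PhragmenLindelof

section HyperbolicTuples

theorem differentiable_exp_add_smul {𝔸 : Type*} [NormedRing 𝔸] [NormedAlgebra ℂ 𝔸]
    [CompleteSpace 𝔸] (a b : 𝔸) : Differentiable ℂ fun z : ℂ => NormedSpace.exp (a + z • b) :=
  fun _ => (NormedSpace.exp_analytic _).differentiableAt.comp _ (by fun_prop)

theorem norm_exp_I_smul_add_I_smul_le {𝔸 : Type*} [NormedRing 𝔸] [NormedAlgebra ℂ 𝔸]
    [CompleteSpace 𝔸] {a b : 𝔸} {K : ℝ} {k : ℕ}
    (h : ∀ x : ℝ, ‖NormedSpace.exp (I • (a + (x : ℂ) • b))‖ ≤ K * (1 + |x|) ^ k) :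
    ‖NormedSpace.exp (I • (a + I • b))‖ ≤ 4 ^ k * K * Real.exp ‖b‖ := by
  have hline (z : ℂ) : I • (a + z • b) = I • a + z • I • b := by rw [smul_add, smul_comm]
  simp only [hline] at h ⊢
  have htype (z : ℂ) : ‖NormedSpace.exp (I • a + z • I • b)‖ ≤
      ‖(1 : 𝔸)‖ * Real.exp ‖a‖ * Real.exp (‖b‖ * ‖z‖) := by
    rw [mul_assoc, ← Real.exp_add]
    refine (norm_exp_le _).trans ?_
    gcongr
    refine (norm_add_le _ _).trans_eq ?_
    rw [norm_smul, norm_smul, norm_smul, norm_I, one_mul, one_mul, mul_comm ‖z‖]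
  refine (norm_le_mul_exp_im_of_forall_real_norm_le (z := I) (differentiable_exp_add_smul _ _)
    htype h (by simp)).trans_eq ?_
  rw [norm_I, I_im, mul_one, show (4 : ℝ) = 2 * (1 + 1) by norm_num, mul_pow]
  ring

theorem one_add_pow_le_mul_exp {δ : ℝ} (hδ : 0 < δ) (k : ℕ) {t : ℝ} (ht : 0 ≤ t) :
    (1 + t) ^ k ≤ k.factorial / δ ^ k * Real.exp δ * Real.exp (δ * t) := by
  have h := Real.pow_div_factorial_le_exp (δ * (1 + t)) (by positivity) k
  rw [mul_add, mul_one, Real.exp_add, div_le_iff₀ (by positivity), ← mul_one_add, mul_pow] at h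
  rw [div_mul_eq_mul_div, div_mul_eq_mul_div, le_div_iff₀ (by positivity)]
  linarith

theorem one_add_norm_add_le {E : Type*} [SeminormedAddCommGroup E] (v w : E) :
    1 + ‖v + w‖ ≤ (1 + ‖v‖) * (1 + ‖w‖) := by
  nlinarith [norm_add_le v w, mul_nonneg (norm_nonneg v) (norm_nonneg w)]

variable {n N : ℕ} (A : Fin n → Matrix (Fin N) (Fin N) ℂ)

theorem tupleNorm_nonneg : 0 ≤ tupleNorm A := Real.sqrt_nonneg _

theorem pairing_add_mul (ξ η : Fin n → ℂ) (z : ℂ) :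
    pairing A (fun j => ξ j + z * η j) = pairing A ξ + z • pairing A η := by
  simp only [pairing, add_smul, Finset.sum_add_distrib, Finset.smul_sum, smul_smul]

theorem norm_pairing_ofReal_le (ξ : EuclideanSpace ℝ (Fin n)) :
    ‖pairing A fun j => (ξ j : ℂ)‖ ≤ tupleNorm A * ‖ξ‖ := by
  rw [tupleNorm, EuclideanSpace.norm_eq, mul_comm]
  calc ‖pairing A fun j => (ξ j : ℂ)‖ ≤ ∑ j, ‖(ξ j : ℂ) • A j‖ := norm_sum_le _ _
    _ = ∑ j, ‖ξ j‖ * ‖A j‖ := by simp only [norm_smul, norm_real]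
    _ ≤ √(∑ j, ‖ξ j‖ ^ 2) * √(∑ j, ‖A j‖ ^ 2) := Real.sum_mul_le_sqrt_mul_sqrt _ _ _

variable {A}

theorem IsHyperbolic.norm_exp_pairing_ofReal_le (hA : IsHyperbolic A)
    (ξ : EuclideanSpace ℝ (Fin n)) :
    ‖NormedSpace.exp (I • pairing A fun j => (ξ j : ℂ))‖ ≤
      (1 + 2 * tupleNorm A) ^ (N - 1) * (1 + ‖ξ‖) ^ (N - 1) := by
  have h := norm_exp_I_smul_le_of_spectrum_subset_real (hA ξ)
  rw [Fintype.card_fin] at h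
  refine h.trans ?_
  rw [← mul_pow]
  gcongr
  linarith [norm_pairing_ofReal_le A ξ, tupleNorm_nonneg A, norm_nonneg ξ]

theorem IsHyperbolic.norm_exp_pairing_le (hA : IsHyperbolic A) (ξ η : EuclideanSpace ℝ (Fin n)) :
    ‖NormedSpace.exp (I • pairing A fun j => (ξ j : ℂ) + I * (η j : ℂ))‖ ≤
      4 ^ (N - 1) * ((1 + 2 * tupleNorm A) ^ (N - 1) * ((1 + ‖ξ‖) * (1 + ‖η‖)) ^ (N - 1)) *
        Real.exp (tupleNorm A * ‖η‖) := by
  have hline (x : ℝ) : (pairing A fun j => (ξ j : ℂ)) + (x : ℂ) • (pairing A fun j => (η j : ℂ)) =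
      pairing A fun j => ((ξ + x • η) j : ℂ) := by
    rw [← pairing_add_mul]
    simp
  have hreal (x : ℝ) : ‖NormedSpace.exp (I • ((pairing A fun j => (ξ j : ℂ)) +
      (x : ℂ) • pairing A fun j => (η j : ℂ)))‖ ≤
      (1 + 2 * tupleNorm A) ^ (N - 1) * ((1 + ‖ξ‖) * (1 + ‖η‖)) ^ (N - 1) *
        (1 + |x|) ^ (N - 1) := by
    rw [hline, mul_assoc, ← mul_pow]
    refine (hA.norm_exp_pairing_ofReal_le _).trans ?_
    have := tupleNorm_nonneg A
    gcongr
    rw [mul_assoc]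
    refine (one_add_norm_add_le _ _).trans ?_
    gcongr
    rw [norm_smul, Real.norm_eq_abs]
    nlinarith [norm_nonneg η, abs_nonneg x]
  rw [pairing_add_mul]
  refine (norm_exp_I_smul_add_I_smul_le hreal).trans ?_
  have := tupleNorm_nonneg A
  gcongr
  exact norm_pairing_ofReal_le A η

theorem IsHyperbolic.exists_norm_exp_pairing_le (hA : IsHyperbolic A) {r : ℝ}
    (hr : tupleNorm A < r) : ∃ C : ℝ, 0 < C ∧ ∀ ξ η : EuclideanSpace ℝ (Fin n),
      ‖NormedSpace.exp (I • pairing A fun j => (ξ j : ℂ) + I * (η j : ℂ))‖ ≤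
        C * (1 + ‖ξ‖) ^ (N - 1) * Real.exp (r * ‖η‖) := by
  have hA0 := tupleNorm_nonneg A
  set δ := r - tupleNorm A
  have hδ : 0 < δ := sub_pos.2 hr
  set c := 4 ^ (N - 1) * (1 + 2 * tupleNorm A) ^ (N - 1)
  set D := (N - 1).factorial / δ ^ (N - 1) * Real.exp δ
  have hc : 0 < c := by positivity
  refine ⟨c * D, mul_pos hc (by positivity), fun ξ η => (hA.norm_exp_pairing_le ξ η).trans ?_⟩
  rw [mul_pow]
  calc 4 ^ (N - 1) * ((1 + 2 * tupleNorm A) ^ (N - 1) * ((1 + ‖ξ‖) ^ (N - 1) * (1 + ‖η‖) ^ (N - 1)))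
        * Real.exp (tupleNorm A * ‖η‖)
      = c * (1 + ‖ξ‖) ^ (N - 1) * Real.exp (tupleNorm A * ‖η‖) * (1 + ‖η‖) ^ (N - 1) := by ring
    _ ≤ c * (1 + ‖ξ‖) ^ (N - 1) * Real.exp (tupleNorm A * ‖η‖) * (D * Real.exp (δ * ‖η‖)) := by
      gcongr
      exact one_add_pow_le_mul_exp hδ _ (norm_nonneg η)
    _ = c * D * (1 + ‖ξ‖) ^ (N - 1) * (Real.exp (tupleNorm A * ‖η‖) * Real.exp (δ * ‖η‖)) := by ring
    _ = c * D * (1 + ‖ξ‖) ^ (N - 1) * Real.exp (r * ‖η‖) := by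
      rw [← Real.exp_add, ← add_mul, add_sub_cancel]

end HyperbolicTuples

section EntireFunctions

variable {E : Type*} [NormedAddCommGroup E] [NormedSpace ℂ E]

theorem aestronglyMeasurable_deriv_of_forall_differentiableAt {α : Type*} [MeasurableSpace α]
    {μ : Measure α} {F : ℂ → α → E} (hmeas : ∀ z, AEStronglyMeasurable (F z) μ) {z : ℂ}
    (hdiff : ∀ a, DifferentiableAt ℂ (fun w => F w a) z) :
    AEStronglyMeasurable (fun a => deriv (fun w => F w a) z) μ := by
  have hseq : Tendsto (fun m : ℕ => z + ((m : ℂ) + 1)⁻¹) atTop (𝓝[≠] z) := by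
    refine tendsto_nhdsWithin_iff.2 ⟨?_, .of_forall fun m => ?_⟩
    · simpa using (tendsto_one_div_add_atTop_nhds_zero_nat (𝕜 := ℂ)).const_add z
    · simpa using Nat.cast_add_one_ne_zero m
  refine aestronglyMeasurable_of_tendsto_ae atTop
    (f := fun (m : ℕ) a => slope (fun w => F w a) z (z + ((m : ℂ) + 1)⁻¹)) (fun m => ?_)
    (.of_forall fun a => (hasDerivAt_iff_tendsto_slope.1 (hdiff a).hasDerivAt).comp hseq)
  simp only [slope_def_module]
  exact ((hmeas _).sub (hmeas _)).const_smul _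

theorem differentiable_integral_of_forall_norm_le {α : Type*} [MeasurableSpace α]
    {μ : Measure α} {F : ℂ → α → E} (hmeas : ∀ z, AEStronglyMeasurable (F z) μ)
    (hdiff : ∀ a, Differentiable ℂ fun z => F z a)
    (hbound : ∀ R : ℝ, ∃ g : α → ℝ, Integrable g μ ∧ ∀ z, ‖z‖ ≤ R → ∀ a, ‖F z a‖ ≤ g a) :
    Differentiable ℂ fun z => ∫ a, F z a ∂μ := by
  intro z
  obtain ⟨g, hg, hFg⟩ := hbound (‖z‖ + 2)
  have hcauchy (a : α) (w : ℂ) (hw : w ∈ ball z 1) : ‖deriv (fun w => F w a) w‖ ≤ g a := by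
    have h := norm_deriv_le_of_forall_mem_sphere_norm_le (c := w) one_pos (hdiff a).diffContOnCl
      fun u hu => hFg u ?_ a
    · simpa using h
    · rw [mem_ball_iff_norm] at hw
      rw [mem_sphere_iff_norm] at hu
      linarith [norm_le_norm_add_norm_sub' u w, norm_le_norm_add_norm_sub' w z]
  exact (hasDerivAt_integral_of_dominated_loc_of_deriv_le (ball_mem_nhds z one_pos)
    (.of_forall hmeas) (hg.mono' (hmeas z) (.of_forall (hFg z (by linarith))))
    (aestronglyMeasurable_deriv_of_forall_differentiableAt hmeas fun a => hdiff a z)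
    (.of_forall hcauchy) hg (.of_forall fun a w _ => (hdiff a w).hasDerivAt)).2.differentiableAt

theorem eq_of_forall_add_ofReal_eq {H : ℂ → E} (hH : Differentiable ℂ H)
    (htrans : ∀ (z : ℂ) (t : ℝ), H (z + t) = H z) (z w : ℂ) : H z = H w := by
  refine is_const_of_deriv_eq_zero hH (fun z => ?_) z w
  have hline : HasDerivAt (fun t : ℝ => z + t) 1 0 :=
    (hasDerivAt_id (0 : ℝ)).ofReal_comp.const_add z
  have hreal : HasDerivAt (fun t : ℝ => H (z + t)) ((1 : ℂ) • deriv H z) 0 :=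
    (hH z).hasDerivAt.scomp_of_eq 0 hline (by simp)
  simp only [htrans, one_smul] at hreal
  exact hreal.unique (hasDerivAt_const _ _)

variable {W : Type*} [NormedAddCommGroup W] [NormedSpace ℂ W]

/-- Entire functions on a complex normed space, encoded as the continuous functions that are
holomorphic along every complex line: continuity makes the restrictions to real slices measurable,
and holomorphy along lines is what moves the contour of an integral. -/
structure IsEntire (G : W → E) : Prop where
  continuous : Continuous G
  differentiable_line (ζ ω : W) : Differentiable ℂ fun z : ℂ => G (ζ + z • ω)

theorem IsEntire.smul {c : W → ℂ} {G : W → E} (hc : IsEntire c) (hG : IsEntire G) :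
    IsEntire fun ζ => c ζ • G ζ where
  continuous := hc.continuous.smul hG.continuous
  differentiable_line ζ ω := (hc.differentiable_line ζ ω).smul (hG.differentiable_line ζ ω)

end EntireFunctions

section FourierLaplace

open LineDeriv

variable {V : Type*} [NormedAddCommGroup V] [NormedSpace ℝ V]

theorem norm_exp_mul_le_of_norm_le {ζ : V →L[ℝ] ℂ} {R : ℝ} (hζ : ‖ζ‖ ≤ R) (x : V) (c : ℂ) :
    ‖Complex.exp (-(I * ζ x)) * c‖ ≤ Real.exp (R * ‖x‖) * ‖c‖ := by
  rw [norm_mul, Complex.norm_exp]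
  gcongr
  calc (-(I * ζ x)).re ≤ ‖-(I * ζ x)‖ := re_le_norm _
    _ = ‖ζ x‖ := by rw [norm_neg, norm_mul, norm_I, one_mul]
    _ ≤ R * ‖x‖ := ζ.le_of_opNorm_le hζ x

variable [MeasureSpace V]

/-- The Fourier–Laplace transform `ζ ↦ ∫ e^{-iζ(x)} f(x) dx` of a function, where `ζ` ranges over
the complex covectors, i.e. over the complexified dual of `V`. -/
noncomputable def fourierLaplace (f : V → ℂ) (ζ : V →L[ℝ] ℂ) : ℂ :=
  ∫ x, Complex.exp (-(I * ζ x)) * f x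

theorem integrable_exp_mul_of_hasCompactSupport [OpensMeasurableSpace V]
    [IsFiniteMeasureOnCompacts (volume : Measure V)] {f : V → ℂ} (hf : Continuous f)
    (hsupp : HasCompactSupport f) (ζ : V →L[ℝ] ℂ) :
    Integrable fun x => Complex.exp (-(I * ζ x)) * f x :=
  Continuous.integrable_of_hasCompactSupport (by fun_prop) hsupp.mul_left

theorem isEntire_fourierLaplace [OpensMeasurableSpace V]
    [IsFiniteMeasureOnCompacts (volume : Measure V)] {f : V → ℂ} (hf : Continuous f)
    (hsupp : HasCompactSupport f) : IsEntire (fourierLaplace f) := by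
  have hmeas (ζ : V →L[ℝ] ℂ) :=
    (integrable_exp_mul_of_hasCompactSupport hf hsupp ζ).aestronglyMeasurable
  have hint (R : ℝ) : Integrable fun x => Real.exp (R * ‖x‖) * ‖f x‖ :=
    Continuous.integrable_of_hasCompactSupport (by fun_prop) hsupp.norm.mul_left
  refine ⟨continuous_iff_continuousAt.2 fun ζ => ?_, fun ζ ω => ?_⟩
  · refine continuousAt_of_dominated (.of_forall hmeas) ?_ (hint (‖ζ‖ + 1))
      (.of_forall fun x => Continuous.continuousAt (by fun_prop))
    filter_upwards [ball_mem_nhds ζ one_pos] with ζ' hζ'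
    have hnorm : ‖ζ'‖ ≤ ‖ζ‖ + 1 := by
      linarith [norm_le_norm_add_norm_sub' ζ' ζ, mem_ball_iff_norm.1 hζ']
    exact .of_forall fun x => norm_exp_mul_le_of_norm_le hnorm x (f x)
  · refine differentiable_integral_of_forall_norm_le (fun z => hmeas (ζ + z • ω))
      (fun x => ?_) fun R => ⟨_, hint (‖ζ‖ + R * ‖ω‖), fun z hz x => ?_⟩
    · simp only [_root_.add_apply, _root_.smul_apply]
      fun_prop
    · refine norm_exp_mul_le_of_norm_le ((norm_add_le _ _).trans ?_) x (f x)
      rw [norm_smul]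
      gcongr

variable [FiniteDimensional ℝ V] [BorelSpace V]

variable [(volume : Measure V).IsAddHaarMeasure]

theorem norm_fourierLaplace_le (f : 𝓢(V, ℂ)) {ζ : V →L[ℝ] ℂ} {s : ℝ}
    (hs : ∀ x ∈ tsupport f, (ζ x).im ≤ s) : ‖fourierLaplace f ζ‖ ≤ Real.exp s * ∫ x, ‖f x‖ := by
  rw [← integral_const_mul]
  refine norm_integral_le_of_norm_le (f.integrable.norm.const_mul _) (.of_forall fun x => ?_)
  rw [norm_mul]
  by_cases hx : x ∈ tsupport f
  · gcongr
    rw [Complex.norm_exp, neg_re, I_mul_re, neg_neg]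
    exact Real.exp_le_exp.2 (hs x hx)
  · simp [image_eq_zero_of_notMem_tsupport hx]

theorem fourierLaplace_lineDerivOp {f : 𝓢(V, ℂ)} (hf : HasCompactSupport f) (ζ : V →L[ℝ] ℂ)
    (v : V) : fourierLaplace (∂_{v} f : 𝓢(V, ℂ)) ζ = I * ζ v * fourierLaplace f ζ := by
  set e : V → ℂ := fun x => Complex.exp (-(I * ζ x))
  have he : Differentiable ℝ e := by fun_prop
  have hderiv (x : V) : fderiv ℝ e x v = -(I * ζ v) * e x := by
    have h : HasFDerivAt e (e x • -(I • ζ)) x := (ζ.hasFDerivAt.const_mul I).fun_neg.cexp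
    rw [h.fderiv]
    simp [mul_comm]
  have hint : Integrable fun x => e x * f x :=
    integrable_exp_mul_of_hasCompactSupport f.continuous hf ζ
  have hint_deriv : Integrable fun x => e x * fderiv ℝ f x v :=
    integrable_exp_mul_of_hasCompactSupport (∂_{v} f : 𝓢(V, ℂ)).continuous
      (hf.of_isClosed_subset (isClosed_tsupport _) (SchwartzMap.tsupport_lineDerivOp_subset v f)) ζ
  have hint_deriv_exp : Integrable fun x => fderiv ℝ e x v * f x := by
    simp only [hderiv, mul_assoc]
    exact hint.const_mul _
  calc fourierLaplace (∂_{v} f : 𝓢(V, ℂ)) ζ = ∫ x, e x * fderiv ℝ f x v := rfl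
    _ = -∫ x, fderiv ℝ e x v * f x :=
      integral_mul_fderiv_eq_neg_fderiv_mul_of_integrable hint_deriv_exp hint_deriv hint
        (fun x _ => he x) (fun x _ => f.differentiableAt)
    _ = I * ζ v * fourierLaplace f ζ := by
      simp only [hderiv, mul_assoc, integral_const_mul, neg_mul, neg_neg, integral_neg]
      rfl

theorem fourierLaplace_iteratedLineDerivOp {f : 𝓢(V, ℂ)} (hf : HasCompactSupport f)
    (ζ : V →L[ℝ] ℂ) (v : V) (m : ℕ) :
    fourierLaplace (∂^{fun _ : Fin m => v} f : 𝓢(V, ℂ)) ζ =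
      (I * ζ v) ^ m * fourierLaplace f ζ := by
  induction m with
  | zero => simp
  | succ m ih =>
    have hsupp : HasCompactSupport (∂^{fun _ : Fin m => v} f : 𝓢(V, ℂ)) :=
      hf.of_isClosed_subset (isClosed_tsupport _)
        (SchwartzMap.tsupport_iteratedLineDerivOp_subset _ f)
    rw [iteratedLineDerivOp_succ_left]
    refine (fourierLaplace_lineDerivOp hsupp ζ v).trans ?_
    rw [ih, pow_succ']
    ring

theorem norm_pow_mul_norm_fourierLaplace_le {f : 𝓢(V, ℂ)} (hf : HasCompactSupport f) (m : ℕ)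
    {ζ : V →L[ℝ] ℂ} {s : ℝ} (hs : ∀ x ∈ tsupport f, (ζ x).im ≤ s) (v : V) :
    ‖ζ v‖ ^ m * ‖fourierLaplace f ζ‖ ≤
      ‖v‖ ^ m * (Real.exp s * ∫ x, ‖iteratedFDeriv ℝ m f x‖) := by
  have hderiv (x : V) : ‖(∂^{fun _ : Fin m => v} f : 𝓢(V, ℂ)) x‖ ≤
      ‖v‖ ^ m * ‖iteratedFDeriv ℝ m f x‖ := by
    rw [SchwartzMap.iteratedLineDerivOp_eq_iteratedFDeriv, mul_comm]
    exact (ContinuousMultilinearMap.le_opNorm _ _).trans_eq (by simp)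
  have hint : Integrable fun x => ‖iteratedFDeriv ℝ m f x‖ := by
    simpa using f.integrable_pow_mul_iteratedFDeriv volume 0 m
  have hle := norm_fourierLaplace_le (∂^{fun _ : Fin m => v} f : 𝓢(V, ℂ)) fun x hx =>
    hs x (SchwartzMap.tsupport_iteratedLineDerivOp_subset _ f hx)
  rw [fourierLaplace_iteratedLineDerivOp hf, norm_mul, norm_pow, norm_mul, norm_I, one_mul] at hle
  refine hle.trans ?_
  rw [mul_left_comm]
  gcongr
  rw [← integral_const_mul]
  exact integral_mono (SchwartzMap.integrable _).norm (hint.const_mul _) hderiv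

end FourierLaplace

section ComplexCovector

variable {V : Type*} [NormedAddCommGroup V] [InnerProductSpace ℝ V]

/-- The complex covector `⟨ξ + iη, ·⟩` on a real inner product space, as a real-linear functional
with complex values. -/
noncomputable def complexCovector (ξ η : V) : V →L[ℝ] ℂ :=
  ofRealCLM ∘L innerSL ℝ ξ + I • (ofRealCLM ∘L innerSL ℝ η)

theorem complexCovector_apply (ξ η x : V) :
    complexCovector ξ η x = (inner ℝ ξ x : ℝ) + I * (inner ℝ η x : ℝ) := rfl

theorem complexCovector_apply_im (ξ η x : V) : (complexCovector ξ η x).im = inner ℝ η x := by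
  simp [complexCovector_apply]

theorem complexCovector_add_re_smul_add_im_smul (ξ η ω : V) (z : ℂ) :
    complexCovector (ξ + z.re • ω) (η + z.im • ω) =
      complexCovector ξ η + z • complexCovector ω 0 := by
  ext x
  conv_rhs => rw [← re_add_im z]
  simp only [complexCovector_apply, inner_add_left, real_inner_smul_left, inner_zero_left,
    _root_.add_apply, _root_.smul_apply, smul_eq_mul]
  push_cast
  ring

theorem norm_sq_le_norm_complexCovector_apply (ξ η : V) : ‖ξ‖ ^ 2 ≤ ‖complexCovector ξ η ξ‖ := by
  refine le_trans (le_of_eq ?_) (re_le_norm _)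
  rw [complexCovector_apply, real_inner_self_eq_norm_sq]
  simp [-ofReal_pow]

variable [MeasureSpace V] [FiniteDimensional ℝ V] [BorelSpace V]
  [(volume : Measure V).IsAddHaarMeasure]

/- The derivative in the direction `ξ` itself multiplies the transform at `ξ + iη` by a factor of
modulus at least `‖ξ‖²`, while it costs only one factor `‖ξ‖`. -/
theorem norm_pow_mul_norm_fourierLaplace_complexCovector_le {f : 𝓢(V, ℂ)}
    (hf : HasCompactSupport f) (m : ℕ) {ξ η : V} {s : ℝ} (hs : ∀ x ∈ tsupport f, inner ℝ η x ≤ s) :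
    ‖ξ‖ ^ m * ‖fourierLaplace f (complexCovector ξ η)‖ ≤
      Real.exp s * ∫ x, ‖iteratedFDeriv ℝ m f x‖ := by
  have him (x : V) (hx : x ∈ tsupport f) : (complexCovector ξ η x).im ≤ s :=
    (complexCovector_apply_im ξ η x).trans_le (hs x hx)
  rcases eq_or_ne ξ 0 with rfl | hξ
  · cases m with
    | zero => simpa using norm_pow_mul_norm_fourierLaplace_le hf 0 him 0
    | succ m =>
      rw [norm_zero, zero_pow m.succ_ne_zero, zero_mul]
      positivity
  refine le_of_mul_le_mul_left ?_ (pow_pos (norm_pos_iff.2 hξ) m)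
  calc ‖ξ‖ ^ m * (‖ξ‖ ^ m * ‖fourierLaplace f (complexCovector ξ η)‖)
      = (‖ξ‖ ^ 2) ^ m * ‖fourierLaplace f (complexCovector ξ η)‖ := by ring
    _ ≤ ‖complexCovector ξ η ξ‖ ^ m * ‖fourierLaplace f (complexCovector ξ η)‖ := by
      gcongr
      exact norm_sq_le_norm_complexCovector_apply ξ η
    _ ≤ _ := norm_pow_mul_norm_fourierLaplace_le hf m him ξ

theorem exists_one_add_norm_pow_mul_norm_fourierLaplace_le {f : 𝓢(V, ℂ)} (hf : HasCompactSupport f)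
    (m : ℕ) : ∃ C : ℝ, 0 ≤ C ∧ ∀ (ξ η : V) (s : ℝ), (∀ x ∈ tsupport f, inner ℝ η x ≤ s) →
      (1 + ‖ξ‖) ^ m * ‖fourierLaplace f (complexCovector ξ η)‖ ≤ C * Real.exp s := by
  refine ⟨2 ^ (m - 1) * ((∫ x, ‖iteratedFDeriv ℝ 0 f x‖) + ∫ x, ‖iteratedFDeriv ℝ m f x‖),
    by positivity, fun ξ η s hs => ?_⟩
  have hzero := norm_pow_mul_norm_fourierLaplace_complexCovector_le (ξ := ξ) hf 0 hs
  have hm := norm_pow_mul_norm_fourierLaplace_complexCovector_le (ξ := ξ) hf m hs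
  rw [pow_zero, one_mul] at hzero
  calc (1 + ‖ξ‖) ^ m * ‖fourierLaplace f (complexCovector ξ η)‖
      ≤ 2 ^ (m - 1) * (1 ^ m + ‖ξ‖ ^ m) * ‖fourierLaplace f (complexCovector ξ η)‖ := by
        gcongr
        exact add_pow_le zero_le_one (norm_nonneg ξ) m
    _ = 2 ^ (m - 1) * (‖fourierLaplace f (complexCovector ξ η)‖ +
          ‖ξ‖ ^ m * ‖fourierLaplace f (complexCovector ξ η)‖) := by ring
    _ ≤ 2 ^ (m - 1) * (Real.exp s * (∫ x, ‖iteratedFDeriv ℝ 0 f x‖) +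
          Real.exp s * ∫ x, ‖iteratedFDeriv ℝ m f x‖) := by gcongr
    _ = _ := by ring

theorem fourierLaplace_complexCovector_zero {n : ℕ} (f : 𝓢(EuclideanSpace ℝ (Fin n), ℂ))
    (ξ : EuclideanSpace ℝ (Fin n)) :
    fourierLaplace f (complexCovector ξ 0) = fourierHat f ξ := by
  simp only [fourierLaplace, fourierHat, complexCovector_apply, inner_zero_left, ofReal_zero,
    mul_zero, add_zero, real_inner_comm]

end ComplexCovector

section ContourShift

variable {V : Type*} [NormedAddCommGroup V]

theorem one_add_norm_add_rpow_neg_le {d : ℝ} (hd : 0 ≤ d) (ξ v : V) :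
    (1 + ‖ξ + v‖) ^ (-d) ≤ (1 + ‖v‖) ^ d * (1 + ‖ξ‖) ^ (-d) := by
  have h := one_add_norm_add_le (ξ + v) (-v)
  rw [add_neg_cancel_right, norm_neg] at h
  rw [Real.rpow_neg (by positivity), Real.rpow_neg (by positivity), ← div_eq_mul_inv,
    inv_le_comm₀ (by positivity) (by positivity), inv_div, div_le_iff₀ (by positivity),
    ← Real.mul_rpow (by positivity) (by positivity)]
  exact Real.rpow_le_rpow (by positivity) h hd

variable [InnerProductSpace ℝ V]

theorem continuous_complexCovector_left (η : V) : Continuous fun ξ => complexCovector ξ η := by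
  unfold complexCovector
  fun_prop

variable [FiniteDimensional ℝ V] [MeasureSpace V] [BorelSpace V]
  [(volume : Measure V).IsAddHaarMeasure] {E : Type*} [NormedAddCommGroup E] [NormedSpace ℂ E]

theorem IsEntire.integral_complexCovector_eq {G : (V →L[ℝ] ℂ) → E} (hG : IsEntire G) {d : ℝ}
    (hd : Module.finrank ℝ V < d)
    (hbound : ∀ R : ℝ, ∃ K : ℝ, ∀ ξ η : V, ‖η‖ ≤ R →
      ‖G (complexCovector ξ η)‖ ≤ K * (1 + ‖ξ‖) ^ (-d)) (η : V) :
    ∫ ξ, G (complexCovector ξ η) = ∫ ξ, G (complexCovector ξ 0) := by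
  have hd0 : 0 ≤ d := (Nat.cast_nonneg _).trans hd.le
  have hline (z : ℂ) (ξ : V) : G (complexCovector ξ 0 + z • complexCovector η 0) =
      G (complexCovector (ξ + z.re • η) (z.im • η)) := by
    rw [← complexCovector_add_re_smul_add_im_smul, zero_add]
  set H : ℂ → E := fun z => ∫ ξ, G (complexCovector ξ 0 + z • complexCovector η 0)
  have hH (z : ℂ) : H z = ∫ ξ, G (complexCovector ξ (z.im • η)) := by
    simp only [H, hline]
    exact integral_add_right_eq_self (fun ξ => G (complexCovector ξ (z.im • η))) _
  have hdiff : Differentiable ℂ H := by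
    refine differentiable_integral_of_forall_norm_le (fun z => ?_)
      (fun ξ => hG.differentiable_line _ _) fun R => ?_
    · exact (hG.continuous.comp ((continuous_complexCovector_left 0).add
        continuous_const)).aestronglyMeasurable
    obtain ⟨K, hK⟩ := hbound (R * ‖η‖)
    refine ⟨fun ξ => |K| * ((1 + R * ‖η‖) ^ d * (1 + ‖ξ‖) ^ (-d)),
      ((integrable_one_add_norm hd).const_mul _).const_mul _, fun z hz ξ => ?_⟩
    have hre : ‖z.re • η‖ ≤ R * ‖η‖ := by
      rw [norm_smul]
      gcongr
      exact (abs_re_le_norm z).trans hz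
    have him : ‖z.im • η‖ ≤ R * ‖η‖ := by
      rw [norm_smul]
      gcongr
      exact (abs_im_le_norm z).trans hz
    rw [hline]
    calc _ ≤ K * (1 + ‖ξ + z.re • η‖) ^ (-d) := hK _ _ him
      _ ≤ |K| * ((1 + ‖z.re • η‖) ^ d * (1 + ‖ξ‖) ^ (-d)) := by
        gcongr
        · exact le_abs_self K
        · exact one_add_norm_add_rpow_neg_le hd0 _ _
      _ ≤ |K| * ((1 + R * ‖η‖) ^ d * (1 + ‖ξ‖) ^ (-d)) := by gcongr
  have hconst := eq_of_forall_add_ofReal_eq hdiff (fun z t => by simp [hH]) I 0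
  simpa [hH] using hconst

end ContourShift

section PaleyWienerSchwartz

variable {V : Type*} [NormedAddCommGroup V] [InnerProductSpace ℝ V] [FiniteDimensional ℝ V]
  [MeasureSpace V] [BorelSpace V] [(volume : Measure V).IsAddHaarMeasure]
  {E : Type*} [NormedAddCommGroup E] [NormedSpace ℂ E] {M : (V →L[ℝ] ℂ) → E} {C r : ℝ} {k : ℕ}

theorem exists_norm_fourierLaplace_smul_le {f : 𝓢(V, ℂ)} (hf : HasCompactSupport f)
    (hM : ∀ ξ η : V, ‖M (complexCovector ξ η)‖ ≤ C * (1 + ‖ξ‖) ^ k * Real.exp (r * ‖η‖)) (d : ℕ) :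
    ∃ K : ℝ, 0 ≤ K ∧ ∀ (ξ η : V) (s : ℝ), (∀ x ∈ tsupport f, inner ℝ η x ≤ s) →
      ‖fourierLaplace f (complexCovector ξ η) • M (complexCovector ξ η)‖ ≤
        K * Real.exp (s + r * ‖η‖) * (1 + ‖ξ‖) ^ (-(d : ℝ)) := by
  have hC : 0 ≤ C := by simpa using (norm_nonneg _).trans (hM 0 0)
  obtain ⟨D, hD, hfD⟩ := exists_one_add_norm_pow_mul_norm_fourierLaplace_le hf (k + d)
  refine ⟨D * C, by positivity, fun ξ η s hs => ?_⟩
  rw [norm_smul, Real.rpow_neg (by positivity), Real.rpow_natCast, ← div_eq_mul_inv,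
    le_div_iff₀ (by positivity), Real.exp_add]
  set p := ‖fourierLaplace f (complexCovector ξ η)‖
  calc p * ‖M (complexCovector ξ η)‖ * (1 + ‖ξ‖) ^ d
      ≤ p * (C * (1 + ‖ξ‖) ^ k * Real.exp (r * ‖η‖)) * (1 + ‖ξ‖) ^ d := by
        gcongr
        exact hM ξ η
    _ = (1 + ‖ξ‖) ^ (k + d) * p * (C * Real.exp (r * ‖η‖)) := by ring
    _ ≤ D * Real.exp s * (C * Real.exp (r * ‖η‖)) :=
        mul_le_mul_of_nonneg_right (hfD ξ η s hs) (by positivity)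
    _ = D * C * (Real.exp s * Real.exp (r * ‖η‖)) := by ring

theorem IsEntire.integral_fourierLaplace_smul_complexCovector_eq (hM : IsEntire M)
    (hbound : ∀ ξ η : V, ‖M (complexCovector ξ η)‖ ≤ C * (1 + ‖ξ‖) ^ k * Real.exp (r * ‖η‖))
    {f : 𝓢(V, ℂ)} (hf : HasCompactSupport f) (η : V) :
    ∫ ξ : V, fourierLaplace f (complexCovector ξ η) • M (complexCovector ξ η) =
      ∫ ξ : V, fourierLaplace f (complexCovector ξ 0) • M (complexCovector ξ 0) := by
  obtain ⟨b, hb⟩ : ∃ b, ∀ x ∈ tsupport f, ‖x‖ ≤ b := hf.isBounded.exists_norm_le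
  obtain ⟨K, hK0, hK⟩ := exists_norm_fourierLaplace_smul_le hf hbound (Module.finrank ℝ V + 1)
  refine ((isEntire_fourierLaplace f.continuous hf).smul hM).integral_complexCovector_eq
    (d := (Module.finrank ℝ V + 1 : ℕ)) (by simp)
    (fun R => ⟨K * Real.exp (R * b + |r| * R), fun ξ η hη => ?_⟩) η
  have hR : 0 ≤ R := (norm_nonneg η).trans hη
  have hs (x : V) (hx : x ∈ tsupport f) : inner ℝ η x ≤ R * b :=
    (real_inner_le_norm η x).trans (mul_le_mul hη (hb x hx) (norm_nonneg x) hR)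
  refine (hK ξ η _ hs).trans ?_
  gcongr
  exact le_abs_self r

/- Moving the contour to imaginary part `-tω` bounds the integral by a multiple of
`e^{-t(ρ - r‖ω‖)}`, which tends to zero as `t → ∞`. -/
theorem IsEntire.integral_fourierLaplace_smul_eq_zero (hM : IsEntire M)
    (hbound : ∀ ξ η : V, ‖M (complexCovector ξ η)‖ ≤ C * (1 + ‖ξ‖) ^ k * Real.exp (r * ‖η‖))
    {f : 𝓢(V, ℂ)} (hf : HasCompactSupport f) {ω : V} {ρ : ℝ} (hρ : r * ‖ω‖ < ρ)
    (hω : ∀ x ∈ tsupport f, ρ ≤ inner ℝ ω x) :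
    ∫ ξ : V, fourierLaplace f (complexCovector ξ 0) • M (complexCovector ξ 0) = 0 := by
  obtain ⟨K, -, hK⟩ := exists_norm_fourierLaplace_smul_le hf hbound (Module.finrank ℝ V + 1)
  set J : ℝ := ∫ ξ : V, (1 + ‖ξ‖) ^ (-((Module.finrank ℝ V + 1 : ℕ) : ℝ))
  have hle (t : ℝ) (ht : 0 ≤ t) :
      ‖∫ ξ : V, fourierLaplace f (complexCovector ξ 0) • M (complexCovector ξ 0)‖ ≤
        K * Real.exp ((r * ‖ω‖ - ρ) * t) * J := by
    rw [← hM.integral_fourierLaplace_smul_complexCovector_eq hbound hf (-t • ω),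
      ← integral_const_mul]
    refine norm_integral_le_of_norm_le ((integrable_one_add_norm (by simp)).const_mul _)
      (.of_forall fun ξ => (hK ξ (-t • ω) (-t * ρ) fun x hx => ?_).trans_eq ?_)
    · rw [real_inner_smul_left]
      exact mul_le_mul_of_nonpos_left (hω x hx) (neg_nonpos.2 ht)
    · rw [norm_smul, norm_neg, Real.norm_of_nonneg ht]
      ring_nf
  have hlim : Tendsto (fun t : ℝ => K * Real.exp ((r * ‖ω‖ - ρ) * t) * J) atTop (𝓝 0) := by
    have h := Real.tendsto_exp_atBot.comp (tendsto_id.const_mul_atTop_of_neg (sub_neg.2 hρ))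
    simpa using (h.const_mul K).mul_const J
  refine norm_le_zero_iff.1 (ge_of_tendsto hlim ?_)
  filter_upwards [eventually_ge_atTop 0] with t ht using hle t ht

theorem IsEntire.dsupport_subset_closedBall (hM : IsEntire M) (hr : 0 ≤ r)
    (hbound : ∀ ξ η : V, ‖M (complexCovector ξ η)‖ ≤ C * (1 + ‖ξ‖) ^ k * Real.exp (r * ‖η‖))
    {W : 𝓢'(V, E)} {c : ℂ} (hW : ∀ f : 𝓢(V, ℂ),
      W f = c • ∫ ξ : V, fourierLaplace f (complexCovector ξ 0) • M (complexCovector ξ 0)) :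
    Distribution.dsupport W ⊆ closedBall 0 r := by
  intro x₀ hx₀
  by_contra hx
  rw [mem_closedBall_zero_iff, not_le] at hx
  have hpos : 0 < ‖x₀‖ := hr.trans_lt hx
  obtain ⟨ρ, hρ, hρx⟩ := exists_between (mul_lt_mul_of_pos_right hx hpos)
  refine (Distribution.notMem_dsupport_iff x₀).2 ⟨{x | ρ < inner ℝ x₀ x} ∩ ball x₀ 1,
    fun f hf => ?_, ?_, ?_, mem_ball_self one_pos⟩ hx₀
  · have hcomp : HasCompactSupport f :=
      isCompact_of_isClosed_isBounded (isClosed_tsupport _)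
        (isBounded_ball.subset fun x hx => (hf hx).2)
    rw [hW, hM.integral_fourierLaplace_smul_eq_zero hbound hcomp hρ fun x hx => (hf hx).1.le,
      smul_zero]
  · exact (isOpen_lt (by fun_prop) (by fun_prop)).inter isOpen_ball
  · rwa [mem_ofPred_eq, real_inner_self_eq_norm_mul_norm]

end PaleyWienerSchwartz

section SlowlyGrowingFunctions

variable {V F : Type*} [NormedAddCommGroup V] [NormedSpace ℝ V] [NormedAddCommGroup F]
  [NormedSpace ℂ F] {M : V → F} {C : ℝ} {k : ℕ}

theorem norm_schwartzMap_smul_le (hM : ∀ x, ‖M x‖ ≤ C * (1 + ‖x‖) ^ k) (d : ℕ) (g : 𝓢(V, ℂ))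
    (x : V) :
    ‖g x • M x‖ ≤ (1 + ‖x‖) ^ (-(d : ℝ)) *
      (C * 2 ^ (k + d) * (Finset.Iic (k + d, 0)).sup (schwartzSeminormFamily ℂ V ℂ) g) := by
  have hC : 0 ≤ C := by simpa using (norm_nonneg _).trans (hM 0)
  have hg := SchwartzMap.one_add_le_sup_seminorm_apply (𝕜 := ℂ) (m := (k + d, 0)) le_rfl le_rfl g x
  rw [norm_iteratedFDeriv_zero] at hg
  rw [Real.rpow_neg (by positivity), Real.rpow_natCast, ← div_eq_inv_mul,
    le_div_iff₀ (by positivity), norm_smul]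
  calc ‖g x‖ * ‖M x‖ * (1 + ‖x‖) ^ d ≤ ‖g x‖ * (C * (1 + ‖x‖) ^ k) * (1 + ‖x‖) ^ d := by
        gcongr
        exact hM x
    _ = C * ((1 + ‖x‖) ^ (k + d) * ‖g x‖) := by ring
    _ ≤ _ := by
        rw [mul_assoc C]
        exact mul_le_mul_of_nonneg_left hg hC

variable [MeasurableSpace V] [OpensMeasurableSpace V]
  {μ : Measure V} [μ.HasTemperateGrowth]

theorem integrable_schwartzMap_smul (hM_meas : AEStronglyMeasurable M μ)
    (hM : ∀ x, ‖M x‖ ≤ C * (1 + ‖x‖) ^ k) (g : 𝓢(V, ℂ)) : Integrable (fun x => g x • M x) μ :=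
  ((Measure.integrable_pow_neg_integrablePower μ).mul_const _).mono'
    (g.continuous.aestronglyMeasurable.smul hM_meas)
    (.of_forall (norm_schwartzMap_smul_le hM μ.integrablePower g))

theorem exists_temperedDistribution_eq_integral_smul (hM_meas : AEStronglyMeasurable M μ)
    (hM : ∀ x, ‖M x‖ ≤ C * (1 + ‖x‖) ^ k) :
    ∃ T : 𝓢'(V, F), ∀ g : 𝓢(V, ℂ), T g = ∫ x, g x • M x ∂μ := by
  have hC : 0 ≤ C := by simpa using (norm_nonneg _).trans (hM 0)
  set d := μ.integrablePower
  have hint := integrable_schwartzMap_smul hM_meas hM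
  refine ⟨ContinuousLinearMap.toPointwiseConvergenceCLM _ _ _ _ <|
    SchwartzMap.mkCLMtoNormedSpace (𝕜 := ℂ) (σ := RingHom.id ℂ) (fun g => ∫ x, g x • M x ∂μ)
      (fun f g => ?_) (fun a f => ?_) ⟨Finset.Iic (k + d, 0),
        (∫ x, (1 + ‖x‖) ^ (-(d : ℝ)) ∂μ) * (C * 2 ^ (k + d)), by positivity, fun g => ?_⟩,
    fun g => rfl⟩
  · simp only [_root_.add_apply, add_smul]
    exact integral_add (hint f) (hint g)
  · simp only [_root_.smul_apply, smul_assoc, RingHom.id_apply]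
    exact integral_smul _ _
  · rw [mul_assoc, ← integral_mul_const]
    exact norm_integral_le_of_norm_le ((Measure.integrable_pow_neg_integrablePower μ).mul_const _)
      (.of_forall (norm_schwartzMap_smul_le hM d g))

end SlowlyGrowingFunctions

section WeylFunctionalCalculus

open FourierTransform

variable {n N : ℕ} {A : Fin n → Matrix (Fin N) (Fin N) ℂ}

theorem fourierHat_two_pi_smul (f : 𝓢(EuclideanSpace ℝ (Fin n), ℂ))
    (ξ : EuclideanSpace ℝ (Fin n)) : fourierHat f ((2 * Real.pi) • ξ) = 𝓕 f ξ := by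
  rw [SchwartzMap.fourier_coe, Real.fourier_eq', fourierHat]
  refine integral_congr_ae (.of_forall fun x => ?_)
  simp only [smul_eq_mul, inner_smul_right]
  congr 2
  push_cast
  ring

/-- The symbol `ζ ↦ e^{i⟨A, ζ⟩}` of the Weyl calculus as a function of the complex covector `ζ`,
whose coordinates are its values on the standard basis. -/
noncomputable def weylSymbol (A : Fin n → Matrix (Fin N) (Fin N) ℂ)
    (ζ : EuclideanSpace ℝ (Fin n) →L[ℝ] ℂ) : Matrix (Fin N) (Fin N) ℂ :=
  NormedSpace.exp (I • pairing A fun j => ζ (EuclideanSpace.single j 1))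

theorem weylSymbol_complexCovector (ξ η : EuclideanSpace ℝ (Fin n)) :
    weylSymbol A (complexCovector ξ η) =
      NormedSpace.exp (I • pairing A fun j => (ξ j : ℂ) + I * (η j : ℂ)) := by
  simp [weylSymbol, complexCovector_apply, EuclideanSpace.inner_single_right]

theorem isEntire_weylSymbol (A : Fin n → Matrix (Fin N) (Fin N) ℂ) : IsEntire (weylSymbol A) where
  continuous := by
    let _ : NormedAlgebra ℚ (Matrix (Fin N) (Fin N) ℂ) := NormedAlgebra.restrictScalars ℚ ℂ _
    refine NormedSpace.exp_continuous.comp ?_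
    unfold pairing
    fun_prop
  differentiable_line ζ ω := by
    simp only [weylSymbol, _root_.add_apply, _root_.smul_apply, smul_eq_mul, pairing_add_mul,
      smul_add, smul_comm I]
    exact differentiable_exp_add_smul _ _

theorem weylIntegrand_eq_fourierLaplace_smul (f : 𝓢(EuclideanSpace ℝ (Fin n), ℂ))
    (ξ : EuclideanSpace ℝ (Fin n)) : weylIntegrand A f ξ =
      fourierLaplace f (complexCovector ξ 0) • weylSymbol A (complexCovector ξ 0) := by
  simp [weylIntegrand, fourierLaplace_complexCovector_zero, weylSymbol_complexCovector]

theorem weylIntegrand_two_pi_smul (f : 𝓢(EuclideanSpace ℝ (Fin n), ℂ))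
    (ξ : EuclideanSpace ℝ (Fin n)) : weylIntegrand A f ((2 * Real.pi) • ξ) =
      𝓕 f ξ • weylSymbol A (complexCovector ((2 * Real.pi) • ξ) 0) := by
  rw [weylIntegrand_eq_fourierLaplace_smul, fourierLaplace_complexCovector_zero,
    fourierHat_two_pi_smul]

theorem IsHyperbolic.exists_isWeylCalculus (hA : IsHyperbolic A) :
    ∃ W : 𝓢'(EuclideanSpace ℝ (Fin n), Matrix (Fin N) (Fin N) ℂ), IsWeylCalculus A W := by
  have hpi : (2 * Real.pi) ≠ 0 := by positivity
  set M : EuclideanSpace ℝ (Fin n) → Matrix (Fin N) (Fin N) ℂ := fun ξ =>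
    weylSymbol A (complexCovector ((2 * Real.pi) • ξ) 0)
  have hmeas : AEStronglyMeasurable M :=
    ((isEntire_weylSymbol A).continuous.comp ((continuous_complexCovector_left 0).comp
      (continuous_const_smul (2 * Real.pi)))).aestronglyMeasurable
  have hM (ξ : EuclideanSpace ℝ (Fin n)) : ‖M ξ‖ ≤
      (1 + 2 * tupleNorm A) ^ (N - 1) * (1 + 2 * Real.pi) ^ (N - 1) * (1 + ‖ξ‖) ^ (N - 1) := by
    have h := hA.norm_exp_pairing_ofReal_le ((2 * Real.pi) • ξ)
    have := tupleNorm_nonneg A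
    simp only [M, weylSymbol_complexCovector, PiLp.zero_apply, ofReal_zero, mul_zero, add_zero]
    refine h.trans ?_
    rw [mul_assoc, ← mul_pow (1 + 2 * Real.pi)]
    gcongr
    rw [norm_smul, Real.norm_of_nonneg (by positivity)]
    nlinarith [norm_nonneg ξ, Real.pi_pos]
  obtain ⟨T, hT⟩ := exists_temperedDistribution_eq_integral_smul hmeas hM
  refine ⟨𝓕 T, fun f => ⟨?_, ?_⟩⟩
  · rw [← integrable_comp_smul_iff volume _ hpi]
    simp only [weylIntegrand_two_pi_smul]
    exact integrable_schwartzMap_smul hmeas hM (𝓕 f)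
  · rw [TemperedDistribution.fourier_apply, hT]
    simp only [M, ← weylIntegrand_two_pi_smul]
    rw [Measure.integral_comp_smul, finrank_euclideanSpace_fin, abs_of_pos (by positivity),
      ← Complex.coe_smul]
    push_cast
    rfl

theorem IsWeylCalculus.dsupport_subset_closedBall
    {W : 𝓢'(EuclideanSpace ℝ (Fin n), Matrix (Fin N) (Fin N) ℂ)} (hW : IsWeylCalculus A W)
    (hA : IsHyperbolic A) {r : ℝ} (hr : tupleNorm A < r) :
    Distribution.dsupport W ⊆ closedBall 0 r := by
  obtain ⟨C, -, hC⟩ := hA.exists_norm_exp_pairing_le hr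
  simp only [← weylSymbol_complexCovector] at hC
  refine (isEntire_weylSymbol A).dsupport_subset_closedBall ((tupleNorm_nonneg A).trans hr.le) hC
    (c := ((2 * Real.pi : ℂ) ^ n)⁻¹) fun f => ?_
  simp only [← weylIntegrand_eq_fourierLaplace_smul]
  exact (hW f).2

end WeylFunctionalCalculus


end WeylCalculus

theorem mainTheorem2 {n N : ℕ} (hN : 1 ≤ N) (A : Fin n → Matrix (Fin N) (Fin N) ℂ)
    (hA : IsHyperbolic A) :
    (∀ r : ℝ, tupleNorm A < r → ∃ C : ℝ, 0 < C ∧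
      ∀ ξ η : EuclideanSpace ℝ (Fin n),
        ‖NormedSpace.exp (Complex.I • pairing A fun j => (ξ j : ℂ) + Complex.I * (η j : ℂ))‖
          ≤ C * (1 + ‖ξ‖) ^ (N - 1) * Real.exp (r * ‖η‖)) ∧
    ∃ W : 𝓢'(EuclideanSpace ℝ (Fin n), Matrix (Fin N) (Fin N) ℂ),
      IsWeylCalculus A W ∧
      IsCompact (Distribution.dsupport W) ∧
      ∀ r : ℝ, tupleNorm A < r →
        Distribution.dsupport W ⊆ Metric.closedBall (0 : EuclideanSpace ℝ (Fin n)) r := by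
  obtain ⟨W, hW⟩ := hA.exists_isWeylCalculus
  exact ⟨fun r hr => hA.exists_norm_exp_pairing_le hr, W, hW,
    (isCompact_closedBall _ _).of_isClosed_subset Distribution.isClosed_dsupport
      (hW.dsupport_subset_closedBall hA (lt_add_one _)),
    fun r hr => hW.dsupport_subset_closedBall hA hr⟩
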